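/- Let $\mathbf{B}$ be a pointed category, i.e. a category with a specified morphism $0_{X,Y}:X\to Y$ for all objects $X,Y$ such that $f\,0_{X,Y}=0_{X,Z}$ and $0_{Y,Z}\,g=0_{X,Z}$ for all $f:Y\to Z$ and $g:X\to Y$ (a zero object is not required). Assume that $\mathbf{B}$ has binary products, binary coproducts (denoted $\sqcup$, with injections $\iota_1,\iota_2$), kernels of split epimorphisms, and coequalizers of reflexive graphs (that is, of pairs $d,c:C_1\to C_0$ with a common section $e$, $de=1=ce$). Let $\mathrm{Pt}(\mathbf{B})$ be the category whose objects are the split epimorphisms $(A,\alpha,\beta,B)$, $\alpha:A\to B$, $\beta:B\to A$, $\alpha\beta=1_B$, and whose morphisms $(A,\alpha,\beta,B)\to(A',\alpha',\beta',B')$ are the pairs $(f_1:A\to A',\,f_0:B\to B')$ with $\alpha'f_1=f_0\alpha$ and $f_1\beta=\beta'f_0$. For objects $B,X$ let $k:B\flat X\to X\sqcup B$ be the kernel of $[0\ 1]:X\sqcup B\to B$; for $g:B\to B'$ and $f:X\to X'$ let $g\flat f:B\flat X\to B'\flat X'$ be the morphism induced by $f\sqcup g$. Let $\eta_X:X\to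 B\flat X$ and $\mu_X:B\flat(B\flat X)\to B\flat X$ be the morphisms induced, respectively, by $\iota_1:X\to X\sqcup B$ and by $[k\ \iota_2]:(B\flat X)\sqcup B\to X\sqcup B$. Let $\mathrm{Act}(\mathbf{B})$ be the category of internal actions: its objects are the triples $(X,\xi,B)$ with $\xi:B\flat X\to X$ satisfying $\xi\eta_X=1$ and $\xi\mu_X=\xi(1\flat\xi)$, and its morphisms $(X,\xi,B)\to(X',\xi',B')$ are the pairs $(g:X\to X',\,f_0:B\to B')$ with $g\,\xi=\xi'(f_0\flat g)$. For an internal action $(X,\xi,B)$ let $\sigma:X\sqcup B\to F(X,\xi,B)$ be the coequalizer of $[k\ \iota_2]$ and $\xi\sqcup 1$, both $(B\flat X)\sqcup B\to X\sqcup B$ (they have the common section $\eta_X\sqcup 1$), and let $\overline{[0\ 1]}:F(X,\xi,B)\to B$ be the unique morphism with $\overline{[0\ 1]}\,\sigma=[0\ 1]$. The canonical functor $$T:\mathrm{Act}(\mathbf{B})\longrightarrow \mathrm{Pt}(\mathbf{B})$$ sends $(X,\xi,B)$ to $(F(X,\xi,B),\overline{[0\ 1]},\sigma\iota_2,B)$,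 and a morphism $(g,f_0)$ to $(f_1,f_0)$, where $f_1$ is the morphism induced by $g\sqcup f_0$ on the coequalizers. **Theorem.** The functor $T$ is an equivalence of categories if and only if the following two properties hold in $\mathbf{B}$: (A1) for every internal action $(X,\xi,B)$, the morphism $\sigma\iota_1:X\to F(X,\xi,B)$ is a kernel of $\overline{[0\ 1]}:F(X,\xi,B)\to B$; (A2) the split short five lemma holds: for every morphism $(h,g):(A,\alpha,\beta,B)\to(A',\alpha',\beta',B')$ in $\mathrm{Pt}(\mathbf{B})$, every kernel $k:X\to A$ of $\alpha$, every kernel $k':X'\to A'$ of $\alpha'$ and every $f:X\to X'$ with $hk=k'f$, if $f$ and $g$ are isomorphisms, then $h$ is an isomorphism. -/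

import Mathlib

open CategoryTheory CategoryTheory.Limits

universe v u

/-- A pointed category (a category with zero morphisms) has kernels of split epimorphisms. -/
class HasKernelsOfSplitEpis (C : Type u) [Category.{v} C] [HasZeroMorphisms C] : Prop where
  hasKernel : ∀ {A B : C} (p : A ⟶ B) [IsSplitEpi p], HasKernel p

/-- An object of `Pt(C)`: a split epimorphism `α : A ⟶ B` together with a chosen section `β`. -/
structure Pt (C : Type u) [Category.{v} C] where
  A : C
  B : C
  α : A ⟶ B
  β : B ⟶ A
  section_comp : β ≫ α = 𝟙 B

namespace Pt

variable {C : Type u} [Category.{v} C]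

/-- A morphism of split epimorphisms, commuting with the projections and with the sections. -/
@[ext]
structure Hom (P Q : Pt C) where
  f₁ : P.A ⟶ Q.A
  f₀ : P.B ⟶ Q.B
  comm_α : f₁ ≫ Q.α = P.α ≫ f₀
  comm_β : P.β ≫ f₁ = f₀ ≫ Q.β

instance : Category (Pt C) where
  Hom := Hom
  id P := ⟨𝟙 _, 𝟙 _, by simp, by simp⟩
  comp f g := ⟨f.f₁ ≫ g.f₁, f.f₀ ≫ g.f₀,
    by rw [Category.assoc, g.comm_α, ← Category.assoc, f.comm_α, Category.assoc],
    by rw [← Category.assoc, f.comm_β, Category.assoc, g.comm_β, Category.assoc]⟩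
  id_comp f := Hom.ext (Category.id_comp f.f₁) (Category.id_comp f.f₀)
  comp_id f := Hom.ext (Category.comp_id f.f₁) (Category.comp_id f.f₀)
  assoc f g h := Hom.ext (Category.assoc f.f₁ g.f₁ h.f₁) (Category.assoc f.f₀ g.f₀ h.f₀)

end Pt

noncomputable section

namespace InternalAction

variable {C : Type u} [Category.{v} C] [HasZeroMorphisms C] [HasBinaryCoproducts C]

/-- The morphism `[0 1] : X ⊔ B ⟶ B`. -/
abbrev proj (X B : C) : X ⨿ B ⟶ B := coprod.desc 0 (𝟙 B)

@[simp]
theorem inl_proj (X B : C) : (coprod.inl : X ⟶ X ⨿ B) ≫ proj X B = 0 :=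
  coprod.inl_desc _ _

@[simp]
theorem inr_proj (X B : C) : (coprod.inr : B ⟶ X ⨿ B) ≫ proj X B = 𝟙 B :=
  coprod.inr_desc _ _

instance proj_isSplitEpi (X B : C) : IsSplitEpi (proj X B) :=
  IsSplitEpi.mk' ⟨coprod.inr, inr_proj X B⟩

variable [HasKernelsOfSplitEpis C]

instance proj_hasKernel (X B : C) : HasKernel (proj X B) :=
  HasKernelsOfSplitEpis.hasKernel _

/-- The object `B ♭ X`, the kernel of `[0 1] : X ⊔ B ⟶ B`. -/
abbrev flat (B X : C) : C := kernel (proj X B)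

/-- The kernel morphism `k : B ♭ X ⟶ X ⊔ B`. -/
abbrev flatι (B X : C) : flat B X ⟶ X ⨿ B := kernel.ι (proj X B)

/-- The morphism `g ♭ f : B ♭ X ⟶ B' ♭ X'` induced by `f ⊔ g : X ⊔ B ⟶ X' ⊔ B'`. -/
def flatMap {B B' X X' : C} (g : B ⟶ B') (f : X ⟶ X') : flat B X ⟶ flat B' X' :=
  kernel.lift _ (flatι B X ≫ coprod.map f g) (by
    have h : coprod.map f g ≫ proj X' B' = proj X B ≫ g := by ext <;> simp
    rw [Category.assoc, h, kernel.condition_assoc, zero_comp])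

@[simp]
theorem flatMap_ι {B B' X X' : C} (g : B ⟶ B') (f : X ⟶ X') :
    flatMap g f ≫ flatι B' X' = flatι B X ≫ coprod.map f g :=
  kernel.lift_ι _ _ _

@[simp]
theorem flatMap_ι_assoc {B B' X X' Z : C} (g : B ⟶ B') (f : X ⟶ X') (h : X' ⨿ B' ⟶ Z) :
    flatMap g f ≫ flatι B' X' ≫ h = flatι B X ≫ coprod.map f g ≫ h := by
  rw [← Category.assoc, flatMap_ι, Category.assoc]

theorem flatMap_id (B X : C) : flatMap (𝟙 B) (𝟙 X) = 𝟙 (flat B X) := by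
  rw [← cancel_mono (flatι B X)]
  simp

theorem flatMap_comp {B B' B'' X X' X'' : C} (g : B ⟶ B') (g' : B' ⟶ B'')
    (f : X ⟶ X') (f' : X' ⟶ X'') :
    flatMap (g ≫ g') (f ≫ f') = flatMap g f ≫ flatMap g' f' := by
  rw [← cancel_mono (flatι B'' X'')]
  simp

/-- The morphism `η : X ⟶ B ♭ X` induced by `ι₁ : X ⟶ X ⊔ B`. -/
def unit (B X : C) : X ⟶ flat B X :=
  kernel.lift _ coprod.inl (inl_proj X B)

/-- The morphism `μ : B ♭ (B ♭ X) ⟶ B ♭ X` induced by `[k ι₂] : (B ♭ X) ⊔ B ⟶ X ⊔ B`. -/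
def mult (B X : C) : flat B (flat B X) ⟶ flat B X :=
  kernel.lift _ (flatι B (flat B X) ≫ coprod.desc (flatι B X) coprod.inr) (by
    have h : coprod.desc (flatι B X) coprod.inr ≫ proj X B = proj (flat B X) B := by
      apply coprod.hom_ext
      · rw [coprod.inl_desc_assoc, kernel.condition, inl_proj]
      · rw [coprod.inr_desc_assoc, inr_proj, inr_proj]
    rw [Category.assoc, h, kernel.condition])

end InternalAction

open InternalAction

/-- An object of `Act(C)`: an internal action `ξ : B ♭ X ⟶ X`. -/
structure Act (C : Type u) [Category.{v} C] [HasZeroMorphisms C] [HasBinaryCoproducts C]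
    [HasKernelsOfSplitEpis C] where
  X : C
  B : C
  ξ : flat B X ⟶ X
  unit_ξ : unit B X ≫ ξ = 𝟙 X
  mult_ξ : mult B X ≫ ξ = flatMap (𝟙 B) ξ ≫ ξ

namespace Act

variable {C : Type u} [Category.{v} C] [HasZeroMorphisms C] [HasBinaryCoproducts C]
  [HasKernelsOfSplitEpis C]

/-- A morphism of internal actions. -/
@[ext]
structure Hom (M N : Act C) where
  g : M.X ⟶ N.X
  f₀ : M.B ⟶ N.B
  comm_ξ : M.ξ ≫ g = flatMap f₀ g ≫ N.ξ

instance : Category (Act C) where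
  Hom := Hom
  id M := ⟨𝟙 _, 𝟙 _, by rw [flatMap_id, Category.comp_id, Category.id_comp]⟩
  comp f g := ⟨f.g ≫ g.g, f.f₀ ≫ g.f₀, by
    rw [← Category.assoc, f.comm_ξ, Category.assoc, g.comm_ξ, flatMap_comp, Category.assoc]⟩
  id_comp f := Hom.ext (Category.id_comp f.g) (Category.id_comp f.f₀)
  comp_id f := Hom.ext (Category.comp_id f.g) (Category.comp_id f.f₀)
  assoc f g h := Hom.ext (Category.assoc f.g g.g h.g) (Category.assoc f.f₀ g.f₀ h.f₀)

/-- The morphism `[k ι₂] : (B ♭ X) ⊔ B ⟶ X ⊔ B`. -/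
abbrev d (M : Act C) : flat M.B M.X ⨿ M.B ⟶ M.X ⨿ M.B :=
  coprod.desc (flatι M.B M.X) coprod.inr

/-- The morphism `ξ ⊔ 1 : (B ♭ X) ⊔ B ⟶ X ⊔ B`. -/
abbrev c (M : Act C) : flat M.B M.X ⨿ M.B ⟶ M.X ⨿ M.B :=
  coprod.map M.ξ (𝟙 M.B)

instance isReflexivePair (M : Act C) : IsReflexivePair M.d M.c :=
  IsReflexivePair.mk' (coprod.map (unit M.B M.X) (𝟙 M.B))
    (by ext <;> simp [unit])
    (by ext <;> simp [M.unit_ξ])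

variable [HasReflexiveCoequalizers C]

instance hasCoequalizer (M : Act C) : HasCoequalizer M.d M.c :=
  HasReflexiveCoequalizers.has_coeq _ _

/-- The object `F(X, ξ, B)`, the coequalizer of `[k ι₂]` and `ξ ⊔ 1`. -/
abbrev F (M : Act C) : C := coequalizer M.d M.c

/-- The quotient morphism `σ : X ⊔ B ⟶ F(X, ξ, B)`. -/
abbrev σ (M : Act C) : M.X ⨿ M.B ⟶ M.F := coequalizer.π M.d M.c

/-- The morphism `F(X, ξ, B) ⟶ B` induced by `[0 1] : X ⊔ B ⟶ B`. -/
def projBar (M : Act C) : M.F ⟶ M.B :=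
  coequalizer.desc (proj M.X M.B) (by
    apply coprod.hom_ext
    · rw [coprod.inl_desc_assoc, kernel.condition, coprod.inl_map_assoc, inl_proj, comp_zero]
    · rw [coprod.inr_desc_assoc, coprod.inr_map_assoc, Category.id_comp])

@[simp]
theorem σ_projBar (M : Act C) : M.σ ≫ M.projBar = proj M.X M.B :=
  coequalizer.π_desc _ _

theorem inl_σ_projBar (M : Act C) : (coprod.inl ≫ M.σ) ≫ M.projBar = 0 := by
  rw [Category.assoc, σ_projBar, inl_proj]

/-- The split epimorphism `(F(X, ξ, B), \overline{[0 1]}, σ ι₂, B)`. -/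
abbrev toPtObj (M : Act C) : Pt C where
  A := M.F
  B := M.B
  α := M.projBar
  β := coprod.inr ≫ M.σ
  section_comp := by rw [Category.assoc, σ_projBar, inr_proj]

/-- The morphism `F(g, f₀) : F(X, ξ, B) ⟶ F(X', ξ', B')` induced by `g ⊔ f₀`. -/
def mapF {M N : Act C} (f : M ⟶ N) : M.F ⟶ N.F :=
  coequalizer.desc (coprod.map f.g f.f₀ ≫ N.σ) (by
    have h : M.d ≫ coprod.map f.g f.f₀ = coprod.map (flatMap f.f₀ f.g) f.f₀ ≫ N.d := by
      ext <;> simp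
    have h' : M.c ≫ coprod.map f.g f.f₀ = coprod.map (flatMap f.f₀ f.g) f.f₀ ≫ N.c := by
      ext <;> simp [f.comm_ξ]
    rw [← Category.assoc, h, ← Category.assoc, h', Category.assoc, Category.assoc,
      coequalizer.condition])

@[simp]
theorem σ_mapF {M N : Act C} (f : M ⟶ N) :
    M.σ ≫ mapF f = coprod.map f.g f.f₀ ≫ N.σ :=
  coequalizer.π_desc _ _

theorem mapF_projBar {M N : Act C} (f : M ⟶ N) : mapF f ≫ N.projBar = M.projBar ≫ f.f₀ := by
  apply coequalizer.hom_ext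
  have h : coprod.map f.g f.f₀ ≫ proj N.X N.B = proj M.X M.B ≫ f.f₀ := by ext <;> simp
  rw [← Category.assoc, ← Category.assoc, σ_mapF, σ_projBar, Category.assoc, σ_projBar, h]

end Act

/-- The canonical functor `T : Act(C) ⥤ Pt(C)`. -/
def Act.toPt (C : Type u) [Category.{v} C] [HasZeroMorphisms C] [HasBinaryCoproducts C]
    [HasKernelsOfSplitEpis C] [HasReflexiveCoequalizers C] : Act C ⥤ Pt C where
  obj M := M.toPtObj
  map f := ⟨Act.mapF f, f.f₀,
    Act.mapF_projBar f,
    by rw [Category.assoc, Act.σ_mapF, coprod.inr_map_assoc]⟩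
  map_id M := Pt.Hom.ext
    (by
      change Act.mapF (𝟙 M) = 𝟙 M.F
      apply coequalizer.hom_ext
      rw [Act.σ_mapF]
      exact (congrArg (· ≫ M.σ) coprod.map_id_id).trans
        ((Category.id_comp _).trans (Category.comp_id _).symm))
    rfl
  map_comp {M N P} f g := Pt.Hom.ext
    (by
      change Act.mapF (f ≫ g) = Act.mapF f ≫ Act.mapF g
      apply coequalizer.hom_ext
      rw [Act.σ_mapF]
      rw [← Category.assoc, Act.σ_mapF, Category.assoc, Act.σ_mapF, ← Category.assoc,
        coprod.map_map]
      rfl)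
    rfl

/-- For every internal action `(X, ξ, B)`, the morphism `σ ι₁ : X ⟶ F(X, ξ, B)` is a kernel of
`\overline{[0 1]} : F(X, ξ, B) ⟶ B`. -/
def Act.InlIsKernel (C : Type u) [Category.{v} C] [HasZeroMorphisms C] [HasBinaryCoproducts C]
    [HasKernelsOfSplitEpis C] [HasReflexiveCoequalizers C] : Prop :=
  ∀ M : Act C,
    Nonempty (IsLimit (KernelFork.ofι (f := M.projBar) (coprod.inl ≫ M.σ) M.inl_σ_projBar))

/-- The split short five lemma: for every morphism of split epimorphisms with given kernels, if
the morphisms between the kernels and between the bases are isomorphisms, then so is the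
middle one. -/
def SplitShortFive (C : Type u) [Category.{v} C] [HasZeroMorphisms C] : Prop :=
  ∀ (P Q : Pt C) (φ : P ⟶ Q) (X X' : C) (k : X ⟶ P.A) (k' : X' ⟶ Q.A)
    (w : k ≫ P.α = 0) (w' : k' ≫ Q.α = 0) (f : X ⟶ X'),
    Nonempty (IsLimit (KernelFork.ofι k w)) →
    Nonempty (IsLimit (KernelFork.ofι k' w')) →
    k ≫ φ.f₁ = f ≫ k' →
    IsIso f → IsIso φ.f₀ → IsIso φ.f₁

end

/-! The functor `T` has a right adjoint `K`, which sends a split epimorphism `(α, β)` to the kernel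
`X` of `α` with the action induced by `[k β] : X ⊔ B ⟶ A`. Indeed, a morphism from `T(M)` to `P` is
determined by a map on `X ⊔ B` coequalizing `[k ι₂]` and `ξ ⊔ 1`, and this coequalizing condition is
precisely equivariance of the induced map from `X` to the kernel.

The unit at `M` is the comparison of `X` with the kernel of `projBar`, so all units are invertible
exactly when (A1) holds. The counit is the identity on bases and, under (A1), also on suitably
chosen kernels, so (A2) inverts it. Conversely, if `T` is an equivalence then so is `K`; hence `K`
reflects isomorphisms, and this is (A2), because `K` retains just the kernel and base components. -/

open InternalAction

/-! ### Componentwise isomorphisms of split epimorphisms and of actions. -/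

namespace Pt

variable {C : Type u} [Category.{v} C]

@[simp]
theorem id_f₁ (P : Pt C) : Hom.f₁ (𝟙 P) = 𝟙 P.A := rfl

@[simp]
theorem comp_f₁ {P Q R : Pt C} (f : P ⟶ Q) (g : Q ⟶ R) : (f ≫ g).f₁ = f.f₁ ≫ g.f₁ := rfl

theorem hom_ext {P Q : Pt C} {f g : P ⟶ Q} (h₁ : f.f₁ = g.f₁) (h₀ : f.f₀ = g.f₀) : f = g :=
  Hom.ext h₁ h₀

theorem isIso_f₁ {P Q : Pt C} (f : P ⟶ Q) [IsIso f] : IsIso f.f₁ :=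
  ⟨(inv f).f₁, by rw [← comp_f₁, IsIso.hom_inv_id, id_f₁],
    by rw [← comp_f₁, IsIso.inv_hom_id, id_f₁]⟩

theorem isIso_of_components {P Q : Pt C} (f : P ⟶ Q) (h₁ : IsIso f.f₁) (h₀ : IsIso f.f₀) :
    IsIso f := by
  refine ⟨⟨inv f.f₁, inv f.f₀, ?_, ?_⟩, hom_ext ?_ ?_, hom_ext ?_ ?_⟩
  · rw [IsIso.inv_comp_eq, ← Category.assoc, f.comm_α, Category.assoc, IsIso.hom_inv_id,
      Category.comp_id]
  · rw [IsIso.comp_inv_eq, Category.assoc, f.comm_β, IsIso.inv_hom_id_assoc]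
  · exact IsIso.hom_inv_id f.f₁
  · exact IsIso.hom_inv_id f.f₀
  · exact IsIso.inv_hom_id f.f₁
  · exact IsIso.inv_hom_id f.f₀

instance isSplitEpi_α (P : Pt C) : IsSplitEpi P.α :=
  IsSplitEpi.mk' ⟨P.β, P.section_comp⟩

variable [HasZeroMorphisms C] [HasKernelsOfSplitEpis C]

instance hasKernel_α (P : Pt C) : HasKernel P.α :=
  HasKernelsOfSplitEpis.hasKernel _

end Pt

namespace Act

variable {C : Type u} [Category.{v} C] [HasZeroMorphisms C] [HasBinaryCoproducts C]
  [HasKernelsOfSplitEpis C]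

@[simp]
theorem id_g (M : Act C) : Hom.g (𝟙 M) = 𝟙 M.X := rfl

@[simp]
theorem comp_g {M N R : Act C} (f : M ⟶ N) (f' : N ⟶ R) : (f ≫ f').g = f.g ≫ f'.g := rfl

@[simp]
theorem comp_f₀ {M N R : Act C} (f : M ⟶ N) (f' : N ⟶ R) : (f ≫ f').f₀ = f.f₀ ≫ f'.f₀ := rfl

theorem hom_ext {M N : Act C} {f f' : M ⟶ N} (h : f.g = f'.g) (h₀ : f.f₀ = f'.f₀) : f = f' :=
  Hom.ext h h₀

theorem isIso_g {M N : Act C} (f : M ⟶ N) [IsIso f] : IsIso f.g :=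
  ⟨(inv f).g, by rw [← comp_g, IsIso.hom_inv_id, id_g],
    by rw [← comp_g, IsIso.inv_hom_id, id_g]⟩

theorem isIso_of_components {M N : Act C} (f : M ⟶ N) (h : IsIso f.g) (h₀ : IsIso f.f₀) :
    IsIso f := by
  refine ⟨⟨inv f.g, inv f.f₀, ?_⟩, hom_ext ?_ ?_, hom_ext ?_ ?_⟩
  -- Functoriality of `♭` makes the inverse pair equivariant.
  · have e : flatMap (inv f.f₀) (inv f.g) ≫ flatMap f.f₀ f.g = 𝟙 _ := by
      rw [← flatMap_comp, IsIso.inv_hom_id, IsIso.inv_hom_id, flatMap_id]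
    rw [IsIso.comp_inv_eq, Category.assoc, f.comm_ξ, ← Category.assoc, e, Category.id_comp]
  · exact IsIso.hom_inv_id f.g
  · exact IsIso.hom_inv_id f.f₀
  · exact IsIso.inv_hom_id f.g
  · exact IsIso.inv_hom_id f.f₀

end Act

noncomputable section

/-! ### The action on the kernel of a split epimorphism. -/

namespace Pt

variable {C : Type u} [Category.{v} C] [HasZeroMorphisms C] [HasBinaryCoproducts C]
  [HasKernelsOfSplitEpis C]

/-- The action `B ♭ X ⟶ X` on the kernel `X` of `α`, induced by `[k β] : X ⊔ B ⟶ A`. -/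
def kernelAction (P : Pt C) : flat P.B (kernel P.α) ⟶ kernel P.α :=
  kernel.lift _ (flatι _ _ ≫ coprod.desc (kernel.ι P.α) P.β) (by
    have h : coprod.desc (kernel.ι P.α) P.β ≫ P.α = proj (kernel P.α) P.B := by
      ext <;> simp [P.section_comp]
    rw [Category.assoc, h, kernel.condition])

@[simp]
theorem kernelAction_ι (P : Pt C) : P.kernelAction ≫ kernel.ι P.α =
    flatι _ _ ≫ coprod.desc (kernel.ι P.α) P.β :=
  kernel.lift_ι _ _ _

/-- The internal action on the kernel of a split epimorphism. -/
abbrev toActObj (P : Pt C) : Act C where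
  X := kernel P.α
  B := P.B
  ξ := P.kernelAction
  unit_ξ := by
    rw [← cancel_mono (kernel.ι P.α)]
    simp only [unit, Category.assoc, kernelAction_ι, kernel.lift_ι_assoc, Category.id_comp]
    exact coprod.inl_desc _ _
  mult_ξ := by
    rw [← cancel_mono (kernel.ι P.α)]
    simp only [mult, Category.assoc, kernelAction_ι, kernel.lift_ι_assoc, flatMap_ι_assoc]
    -- Both sides now start with the same kernel inclusion; the remaining maps agree on each summand
    -- of `(B ♭ X) ⊔ B`.
    congr 1
    apply coprod.hom_ext
    · rw [coprod.inl_desc_assoc, coprod.inl_map_assoc, coprod.inl_desc, kernelAction_ι]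
    · rw [coprod.inr_desc_assoc, coprod.inr_map_assoc, Category.id_comp]

/-- The morphism induced on kernels by a morphism of split epimorphisms. -/
abbrev mapKernel {P Q : Pt C} (φ : P ⟶ Q) : kernel P.α ⟶ kernel Q.α :=
  kernel.map _ _ φ.f₁ φ.f₀ φ.comm_α.symm

variable (C) in
/-- The functor `Pt(C) ⥤ Act(C)` sending a split epimorphism to the action on its kernel. -/
def toAct : Pt C ⥤ Act C where
  obj P := P.toActObj
  map {P Q} φ := ⟨mapKernel φ, φ.f₀, by
    rw [← cancel_mono (kernel.ι Q.α)]
    have h : coprod.desc (kernel.ι P.α) P.β ≫ φ.f₁ =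
        coprod.map (mapKernel φ) φ.f₀ ≫ coprod.desc (kernel.ι Q.α) Q.β := by
      ext <;> simp [φ.comm_β]
    calc (P.kernelAction ≫ mapKernel φ) ≫ kernel.ι Q.α
        = (P.kernelAction ≫ kernel.ι P.α) ≫ φ.f₁ := by
          rw [Category.assoc, kernel.lift_ι, Category.assoc]
      _ = flatι _ _ ≫ coprod.desc (kernel.ι P.α) P.β ≫ φ.f₁ := by
          rw [kernelAction_ι, Category.assoc]
      _ = (flatMap φ.f₀ (mapKernel φ) ≫ Q.kernelAction) ≫ kernel.ι Q.α := by
          rw [h, Category.assoc, kernelAction_ι, flatMap_ι_assoc]⟩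
  map_id P := Act.hom_ext
    (by rw [← cancel_mono (kernel.ι P.α)]; simp) rfl
  map_comp {P Q R} φ ψ := Act.hom_ext
    (by rw [← cancel_mono (kernel.ι R.α)]; simp) rfl

end Pt

/-! ### The adjunction, its unit and its counit. -/

namespace Act

variable {C : Type u} [Category.{v} C] [HasZeroMorphisms C] [HasBinaryCoproducts C]
  [HasKernelsOfSplitEpis C] [HasReflexiveCoequalizers C]

/-- The transpose of a morphism `T(M) ⟶ P`. -/
def homToAct {M : Act C} {P : Pt C} (φ : M.toPtObj ⟶ P) : M ⟶ P.toActObj where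
  g := kernel.lift _ (coprod.inl ≫ M.σ ≫ φ.f₁) (by
    rw [Category.assoc, Category.assoc, φ.comm_α, ← Category.assoc, ← Category.assoc,
      M.inl_σ_projBar, zero_comp])
  f₀ := φ.f₀
  comm_ξ := by
    rw [← cancel_mono (kernel.ι P.α)]
    have hβ : coprod.inr ≫ M.σ ≫ φ.f₁ = φ.f₀ ≫ P.β := by
      rw [← Category.assoc]; exact φ.comm_β
    have hσ : M.d ≫ M.σ = M.c ≫ M.σ := coequalizer.condition _ _
    -- The only nontrivial component of the coequalizer relation: in `F`, the inclusion of `B ♭ X`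
    -- becomes the action.
    have hk : flatι M.B M.X ≫ M.σ = M.ξ ≫ coprod.inl ≫ M.σ := by
      have := coprod.inl ≫= hσ
      rwa [coprod.inl_desc_assoc, coprod.inl_map_assoc] at this
    simp only [Category.assoc, kernel.lift_ι, Pt.kernelAction_ι, flatMap_ι_assoc,
      coprod.map_desc]
    rw [← hβ, ← reassoc_of% hk]
    congr 1
    apply coprod.hom_ext
    · rw [coprod.inl_desc]
    · rw [coprod.inr_desc]

@[simp]
theorem homToAct_g_ι {M : Act C} {P : Pt C} (φ : M.toPtObj ⟶ P) :
    (homToAct φ).g ≫ kernel.ι P.α = coprod.inl ≫ M.σ ≫ φ.f₁ :=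
  kernel.lift_ι _ _ _

/-- The transpose of a morphism `M ⟶ K(P)`. -/
def homToPt {M : Act C} {P : Pt C} (f : M ⟶ P.toActObj) : M.toPtObj ⟶ P where
  f₁ := coequalizer.desc (coprod.desc (f.g ≫ kernel.ι P.α) (f.f₀ ≫ P.β)) (by
    -- Equivariance, read in `P.A`, is the coequalizing condition on the summand `B ♭ X`; on `B`
    -- there is nothing to check.
    have h := f.comm_ξ =≫ kernel.ι P.α
    rw [Category.assoc, Category.assoc, Pt.kernelAction_ι, flatMap_ι_assoc,
      coprod.map_desc] at h
    apply coprod.hom_ext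
    · rw [coprod.inl_desc_assoc, coprod.inl_map_assoc, coprod.inl_desc]
      exact h.symm
    · rw [coprod.inr_desc_assoc, coprod.inr_map_assoc, Category.id_comp])
  f₀ := f.f₀
  comm_α := by
    apply coequalizer.hom_ext
    rw [coequalizer.π_desc_assoc]
    change _ = M.σ ≫ M.projBar ≫ f.f₀
    rw [← Category.assoc M.σ, σ_projBar]
    ext <;> simp [P.section_comp]
  comm_β := by rw [Category.assoc, coequalizer.π_desc, coprod.inr_desc]

@[simp]
theorem σ_homToPt_f₁ {M : Act C} {P : Pt C} (f : M ⟶ P.toActObj) :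
    M.σ ≫ (homToPt f).f₁ = coprod.desc (f.g ≫ kernel.ι P.α) (f.f₀ ≫ P.β) :=
  coequalizer.π_desc _ _

theorem homToPt_homToAct {M : Act C} {P : Pt C} (φ : M.toPtObj ⟶ P) :
    homToPt (homToAct φ) = φ := by
  refine Pt.hom_ext ?_ rfl
  apply coequalizer.hom_ext
  refine (σ_homToPt_f₁ _).trans ?_
  have hβ : coprod.inr ≫ M.σ ≫ φ.f₁ = φ.f₀ ≫ P.β := by
    rw [← Category.assoc]; exact φ.comm_β
  apply coprod.hom_ext
  · rw [coprod.inl_desc, homToAct_g_ι]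
  · rw [coprod.inr_desc]
    exact hβ.symm

theorem homToAct_homToPt {M : Act C} {P : Pt C} (f : M ⟶ P.toActObj) :
    homToAct (homToPt f) = f := by
  refine hom_ext ?_ rfl
  rw [← cancel_mono (kernel.ι P.α), homToAct_g_ι, σ_homToPt_f₁, coprod.inl_desc]

theorem homToPt_comp {M N : Act C} {P : Pt C} (f : M ⟶ N) (φ : N ⟶ P.toActObj) :
    homToPt (f ≫ φ) = (toPt C).map f ≫ homToPt φ := by
  refine Pt.hom_ext ?_ rfl
  apply coequalizer.hom_ext
  change M.σ ≫ (homToPt (f ≫ φ)).f₁ = M.σ ≫ mapF f ≫ (homToPt φ).f₁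
  rw [← Category.assoc, σ_mapF, Category.assoc, σ_homToPt_f₁, σ_homToPt_f₁]
  ext <;> simp

theorem homToAct_comp {M : Act C} {P Q : Pt C} (φ : M.toPtObj ⟶ P) (ψ : P ⟶ Q) :
    homToAct (φ ≫ ψ) = homToAct φ ≫ (Pt.toAct C).map ψ := by
  refine hom_ext ?_ rfl
  change (homToAct (φ ≫ ψ)).g = (homToAct φ).g ≫ Pt.mapKernel ψ
  rw [← cancel_mono (kernel.ι Q.α), homToAct_g_ι, Category.assoc, kernel.lift_ι,
    ← Category.assoc (homToAct φ).g, homToAct_g_ι]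
  simp

variable (C) in
/-- The functor `T` is left adjoint to the functor taking the action on the kernel. -/
def toPtAdjunction : Act.toPt C ⊣ Pt.toAct C :=
  Adjunction.mkOfHomEquiv
    { homEquiv _ _ :=
        { toFun := homToAct
          invFun := homToPt
          left_inv := homToPt_homToAct
          right_inv := homToAct_homToPt }
      homEquiv_naturality_left_symm f φ := homToPt_comp f φ
      homEquiv_naturality_right φ ψ := homToAct_comp φ ψ }

theorem toPtAdjunction_unit_app (M : Act C) :
    (toPtAdjunction C).unit.app M = homToAct (𝟙 M.toPtObj) := rfl

theorem toPtAdjunction_counit_app (P : Pt C) :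
    (toPtAdjunction C).counit.app P = homToPt (𝟙 P.toActObj) := rfl

instance hasKernel_projBar (M : Act C) : HasKernel M.projBar :=
  Pt.hasKernel_α M.toPtObj

/-- The base component of the unit is an identity, and its kernel component is the unique
factorization of `σ ι₁` through the kernel of `projBar`. -/
theorem isIso_unit_app_iff (M : Act C) :
    IsIso ((toPtAdjunction C).unit.app M) ↔
      Nonempty (IsLimit (KernelFork.ofι (f := M.projBar) (coprod.inl ≫ M.σ) M.inl_σ_projBar)) := by
  rw [toPtAdjunction_unit_app]
  have hι : (homToAct (𝟙 M.toPtObj)).g ≫ kernel.ι M.projBar = coprod.inl ≫ M.σ := by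
    rw [homToAct_g_ι, Pt.id_f₁, Category.comp_id]
  constructor
  · intro (h : IsIso (homToAct (𝟙 M.toPtObj)))
    have := isIso_g (homToAct (𝟙 M.toPtObj))
    exact ⟨kernel.isoKernel M.projBar _ (asIso (homToAct (𝟙 M.toPtObj)).g) hι⟩
  · rintro ⟨h⟩
    refine isIso_of_components _ ?_ (inferInstanceAs (IsIso (𝟙 M.B)))
    let e := h.conePointUniqueUpToIso (kernelIsKernel M.projBar)
    have he : e.hom ≫ kernel.ι M.projBar = coprod.inl ≫ M.σ :=
      h.conePointUniqueUpToIso_hom_comp (kernelIsKernel M.projBar) WalkingParallelPair.zero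
    have : (homToAct (𝟙 M.toPtObj)).g = e.hom := by
      rw [← cancel_mono (kernel.ι M.projBar), hι]
      exact he.symm
    rw [this]
    exact inferInstanceAs (IsIso e.hom)

theorem isIso_counit_app (hk : InlIsKernel C) (hs : SplitShortFive C) (P : Pt C) :
    IsIso ((toPtAdjunction C).counit.app P) := by
  rw [toPtAdjunction_counit_app]
  have h₀ : IsIso (homToPt (𝟙 P.toActObj)).f₀ := inferInstanceAs (IsIso (𝟙 P.B))
  refine Pt.isIso_of_components _ ?_ h₀
  -- By (A1), `σ ι₁` serves as the kernel on the source side, so the map between kernels is an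
  -- identity.
  refine hs _ _ (homToPt (𝟙 P.toActObj)) _ _ _ (kernel.ι P.α) P.toActObj.inl_σ_projBar
    (kernel.condition _) (𝟙 _) (hk P.toActObj) ⟨kernelIsKernel P.α⟩ ?_ inferInstance h₀
  rw [Category.assoc, σ_homToPt_f₁, coprod.inl_desc, id_g]

end Act

namespace Pt

variable {C : Type u} [Category.{v} C] [HasZeroMorphisms C] [HasBinaryCoproducts C]
  [HasKernelsOfSplitEpis C]

/-- Up to the comparison isomorphisms with the chosen kernels, `f` is the kernel component of
`(toAct C).map φ`, so that image is invertible and reflection applies. -/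
theorem splitShortFive_of_reflectsIsomorphisms [(toAct C).ReflectsIsomorphisms] :
    SplitShortFive C := by
  rintro P Q φ X X' k k' w w' f ⟨hk⟩ ⟨hk'⟩ h hf h₀
  let e := hk.conePointUniqueUpToIso (kernelIsKernel P.α)
  let e' := hk'.conePointUniqueUpToIso (kernelIsKernel Q.α)
  have he : e.hom ≫ kernel.ι P.α = k :=
    hk.conePointUniqueUpToIso_hom_comp (kernelIsKernel P.α) WalkingParallelPair.zero
  have he' : e'.hom ≫ kernel.ι Q.α = k' :=
    hk'.conePointUniqueUpToIso_hom_comp (kernelIsKernel Q.α) WalkingParallelPair.zero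
  have hsq : e.hom ≫ mapKernel φ = f ≫ e'.hom := by
    apply (cancel_mono (kernel.ι Q.α)).1
    rw [Category.assoc, Category.assoc, kernel.lift_ι, he', ← h]
    exact (Category.assoc _ _ _).symm.trans (he =≫ φ.f₁)
  have hm : IsIso (mapKernel φ) := by
    have : IsIso (e.hom ≫ mapKernel φ) := by
      rw [hsq]
      exact inferInstanceAs (IsIso (f ≫ e'.hom))
    exact IsIso.of_isIso_comp_left e.hom _
  have : IsIso ((toAct C).map φ) := Act.isIso_of_components _ hm h₀
  have := isIso_of_reflects_iso φ (toAct C)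
  exact isIso_f₁ φ

end Pt

end

theorem mainTheorem4 (C : Type u) [Category.{v} C] [HasZeroMorphisms C]
    [HasBinaryProducts C] [HasBinaryCoproducts C] [HasKernelsOfSplitEpis C]
    [HasReflexiveCoequalizers C] :
    (Act.toPt C).IsEquivalence ↔ Act.InlIsKernel C ∧ SplitShortFive C := by
  constructor
  · intro h
    -- The right adjoint of an equivalence is an equivalence, hence reflects isomorphisms.
    have := (Act.toPtAdjunction C).isEquivalence_right_of_isEquivalence_left
    exact ⟨fun M => (Act.isIso_unit_app_iff M).1 inferInstance,
      Pt.splitShortFive_of_reflectsIsomorphisms⟩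
  · rintro ⟨hk, hs⟩
    have : ∀ M, IsIso ((Act.toPtAdjunction C).unit.app M) :=
      fun M => (Act.isIso_unit_app_iff M).2 (hk M)
    have := Act.isIso_counit_app hk hs
    exact (Act.toPtAdjunction C).toEquivalence.isEquivalence_functor
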